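/- Consider the Mean-Thinning process on $n$ bins, started from empty bins: in each round $t = 0, 1, 2, \ldots$ (so that $t$ balls have been allocated so far) sample a bin uniformly at random; if its load is smaller than the mean load $t/n$, put one ball into it; otherwise sample a second bin, independently and uniformly at random, and put one ball into that second bin. Let $W^m$ be the number of balls allocated and $S^m$ the number of bin samples taken in the first $m$ rounds (one sample in a round whose first sample has load below the mean, two samples in every other round), and let $\eta^m := W^m / S^m$ be the sample efficiency. There is a constant $\rho > 0$ such that for all integers $n \geq 2$ and all integers $m \geq \rho^{-1} \cdot n \log n$, \[ \mathbf{E}[\eta^m] \geq \frac12 + \rho \qquad\text{and}\qquad \mathbf{Pr}\Big[\eta^m \geq \frac12 + \rho\Big] \geq 1 - n^{-1/4}. \] -/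

import Mathlib

open MeasureTheory

noncomputable section

namespace MeanThinning

/-- A state of the process on `n` bins: `loads i` is the number of balls in bin `i`, and `samples`
is the total number of bin samples taken so far. It is the pair `(loads, samples)`. -/
abbrev State (n : ℕ) : Type := (Fin n → ℕ) × ℕ

/-- The load vector `x` after one more ball has been allocated to bin `i`. -/
def addBall {n : ℕ} (x : Fin n → ℕ) (i : Fin n) : Fin n → ℕ :=
  Function.update x i (x i + 1)

/-- One round of Mean-Thinning, carried out after `t` balls have been allocated: take a uniform
sample `i₁`. If its load is below the mean load `t / n`, the ball goes to `i₁`, at the cost of one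
sample. Otherwise a second, independent uniform sample `i₂` is taken and the ball goes to `i₂`, at
the cost of two samples. -/
def step {n : ℕ} [NeZero n] (t : ℕ) (σ : State n) : PMF (State n) :=
  (PMF.uniformOfFintype (Fin n)).bind fun i₁ =>
    if (σ.1 i₁ : ℝ) < (t : ℝ) / (n : ℝ) then
      PMF.pure (addBall σ.1 i₁, σ.2 + 1)
    else
      (PMF.uniformOfFintype (Fin n)).bind fun i₂ =>
        PMF.pure (addBall σ.1 i₂, σ.2 + 2)

/-- The distribution of the state of Mean-Thinning on `n` bins after `t` rounds, starting from
empty bins. -/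
def law (n : ℕ) [NeZero n] : ℕ → PMF (State n)
  | 0 => PMF.pure (fun _ => 0, 0)
  | t + 1 => (law n t).bind (step t)

/-- The corresponding probability measure on states. -/
def prob (n : ℕ) [NeZero n] (t : ℕ) : Measure (State n) := (law n t).toMeasure

/-- The sample efficiency `η = W / S`: the total number `W` of balls in the bins divided by the
total number `S` of samples taken. -/
def efficiency {n : ℕ} (σ : State n) : ℝ :=
  ((∑ i, σ.1 i : ℕ) : ℝ) / (σ.2 : ℝ)

end MeanThinning

end

noncomputable section

namespace MeanThinning

open scoped ENNReal

/-! Every round takes one or two samples, so it suffices that one-sample rounds form a constant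
fraction of all rounds; `2 * t - σ.2` counts them. `potential` rewards this count and compares it
with `t / 4`, and `roundMean_drift_nonneg` makes it a submartingale. Underloaded first samples earn
649. When they are rare, moderately overloaded bins behave like nearly unbiased walks, on which the
convex `profile` gains a constant; at very heavy bins this gain fails, but then underloaded bins are
deep (excesses sum to zero) and `quadratic` falls enough in expectation to compensate.

Increments of `potential` grow with the loads, so concentration comes from a second moment:
`deficit` adds to the squared negative part a multiple of `quadratic` that shrinks with time and
pays for the variance. Chebyshev then gives `potential T σ > -T / 8` outside probability `3 / (4 *
n)`. There the one-sample rounds are linear in `T`, because the profile sum is at most `324 * n` and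
`quadratic` enters negatively. The expectation bound follows since the efficiency is always at least
`1 / 2`. -/

lemma tsum_bind_mul {α β : Type*} (p : PMF α) (f : α → PMF β) (F : β → ℝ≥0∞) :
    ∑' b, (p.bind f) b * F b = ∑' a, p a * ∑' b, f a b * F b := by
  simp only [PMF.bind_apply, ← ENNReal.tsum_mul_right, ← ENNReal.tsum_mul_left]
  rw [ENNReal.tsum_comm]
  simp only [mul_assoc]

lemma tsum_pure_mul {α : Type*} (a : α) (F : α → ℝ≥0∞) :
    ∑' b, (PMF.pure a) b * F b = F a := by
  rw [tsum_eq_single a]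
  · simp
  · intro b hb
    simp [PMF.pure_apply, hb]

/-- The conditional expectation of `h` after one round, as a finite sum. -/
def stepMean {n : ℕ} (t : ℕ) (σ : State n) (h : State n → ℝ) : ℝ :=
  (n : ℝ)⁻¹ * ∑ i, if (σ.1 i : ℝ) < (t : ℝ) / (n : ℝ) then h (addBall σ.1 i, σ.2 + 1)
    else (n : ℝ)⁻¹ * ∑ j, h (addBall σ.1 j, σ.2 + 2)

lemma tsum_uniform_mul {n : ℕ} [NeZero n] (h : Fin n → ℝ) (h0 : ∀ i, 0 ≤ h i) :
    ∑' i, (PMF.uniformOfFintype (Fin n)) i * ENNReal.ofReal (h i)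
      = ENNReal.ofReal ((n : ℝ)⁻¹ * ∑ i, h i) := by
  have hn : 0 < (n : ℝ) := by exact_mod_cast Nat.pos_of_ne_zero (NeZero.ne n)
  rw [tsum_fintype, ENNReal.ofReal_mul (by positivity), ENNReal.ofReal_sum_of_nonneg
    (fun i _ => h0 i), Finset.mul_sum, ENNReal.ofReal_inv_of_pos hn]
  simp [PMF.uniformOfFintype_apply]

lemma tsum_step_mul {n : ℕ} [NeZero n] (t : ℕ) (σ : State n) (h : State n → ℝ)
    (h0 : ∀ σ, 0 ≤ h σ) :
    ∑' τ, step t σ τ * ENNReal.ofReal (h τ) = ENNReal.ofReal (stepMean t σ h) := by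
  unfold step stepMean
  rw [tsum_bind_mul, ← tsum_uniform_mul]
  · refine tsum_congr fun i => ?_
    congr 1
    split_ifs
    · rw [tsum_pure_mul]
    · rw [tsum_bind_mul, ← tsum_uniform_mul _ (fun _ => h0 _)]
      simp only [tsum_pure_mul]
  · intro i
    split_ifs
    · exact h0 _
    · exact mul_nonneg (by positivity) (Finset.sum_nonneg fun _ _ => h0 _)

/-- The invariants of the states reachable in `t` rounds. -/
def Reachable {n : ℕ} (t : ℕ) (σ : State n) : Prop :=
  ∑ i, σ.1 i = t ∧ t ≤ σ.2 ∧ σ.2 ≤ 2 * t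

lemma sum_addBall {n : ℕ} (x : Fin n → ℕ) (i : Fin n) :
    ∑ j, addBall x i j = ∑ j, x j + 1 := by
  unfold addBall
  rw [Finset.sum_update_of_mem (Finset.mem_univ i),
    ← Finset.add_sum_erase Finset.univ x (Finset.mem_univ i), Finset.sdiff_singleton_eq_erase]
  ring

lemma reachable_of_mem_support {n : ℕ} [NeZero n] (t : ℕ) (σ : State n)
    (h : σ ∈ (law n t).support) : Reachable t σ := by
  induction t generalizing σ with
  | zero =>
    simp only [law, PMF.support_pure, Set.mem_singleton_iff] at h
    subst h
    simp [Reachable]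
  | succ t ih =>
    simp only [law, PMF.mem_support_bind_iff] at h
    obtain ⟨τ, hτ, h⟩ := h
    obtain ⟨h1, h2, h3⟩ := ih τ hτ
    simp only [step, PMF.mem_support_bind_iff] at h
    obtain ⟨i, -, h⟩ := h
    split_ifs at h
    · simp only [PMF.support_pure, Set.mem_singleton_iff] at h
      subst h
      refine ⟨?_, ?_, ?_⟩ <;> simp only [sum_addBall] <;> omega
    · simp only [PMF.mem_support_bind_iff, PMF.support_pure, Set.mem_singleton_iff] at h
      obtain ⟨j, -, h⟩ := h
      subst h
      refine ⟨?_, ?_, ?_⟩ <;> simp only [sum_addBall] <;> omega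

/-- A nonnegative potential whose conditional one-round increase is at most `b` has mean at most
`b * t` after `t ≤ T` rounds. -/
lemma tsum_law_mul_le {n : ℕ} [NeZero n] (T : ℕ) (b : ℝ) (hb : 0 ≤ b) (f : ℕ → State n → ℝ)
    (f0 : ∀ t ≤ T, ∀ σ, 0 ≤ f t σ) (hf0 : f 0 (fun _ => 0, 0) = 0)
    (hf : ∀ t < T, ∀ σ, Reachable t σ → stepMean t σ (f (t + 1)) ≤ f t σ + b) (t : ℕ) (ht : t ≤ T) :
    ∑' σ, law n t σ * ENNReal.ofReal (f t σ) ≤ ENNReal.ofReal (b * t) := by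
  induction t with
  | zero => simp [law, hf0]
  | succ t ih =>
    have h1 : ∑' σ, law n (t + 1) σ * ENNReal.ofReal (f (t + 1) σ)
        ≤ ∑' σ, (law n t σ * ENNReal.ofReal (f t σ) + law n t σ * ENNReal.ofReal b) := by
      simp only [law]
      rw [tsum_bind_mul]
      refine ENNReal.tsum_le_tsum fun σ => ?_
      rw [tsum_step_mul _ _ _ (f0 _ ht)]
      -- Unreachable states carry no mass, so the drift bound is needed only on reachable ones.
      by_cases hσ : law n t σ = 0
      · simp [hσ]
      · rw [← mul_add, ← ENNReal.ofReal_add (f0 t (by omega) σ) hb]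
        gcongr
        exact hf t (by omega) σ (reachable_of_mem_support t σ ((PMF.mem_support_iff _ _).2 hσ))
    rw [ENNReal.tsum_add, ENNReal.tsum_mul_right, PMF.tsum_coe, one_mul] at h1
    refine h1.trans ((add_le_add_left (ih (by omega)) _).trans ?_)
    rw [← ENNReal.ofReal_add (by positivity) hb]
    apply ENNReal.ofReal_le_ofReal
    push_cast
    linarith

lemma lintegral_prob {n : ℕ} [NeZero n] (t : ℕ) (F : State n → ℝ≥0∞) :
    ∫⁻ σ, F σ ∂prob n t = ∑' σ, law n t σ * F σ := by
  rw [prob, lintegral_countable']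
  refine tsum_congr fun σ => ?_
  rw [PMF.toMeasure_apply_singleton _ _ (measurableSet_singleton σ), mul_comm]

instance {n : ℕ} [NeZero n] (t : ℕ) : IsProbabilityMeasure (prob n t) := by
  unfold prob; infer_instance

lemma ae_reachable {n : ℕ} [NeZero n] (t : ℕ) : ∀ᵐ σ ∂prob n t, Reachable t σ := by
  rw [ae_iff, ← nonpos_iff_eq_zero, prob]
  refine (PMF.toMeasure_apply_eq_zero_iff _ (Set.to_countable _).measurableSet).2 ?_ |>.le
  rw [Set.disjoint_left]
  intro σ h1 h2
  exact h2 (reachable_of_mem_support t σ h1)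

/-! ### The convex profile of a load -/

/-- A bounded Lipschitz decreasing function of the normalised load, convex on `[-1, ∞)`. -/
def profile (y : ℝ) : ℝ := (max 0 (min (17 - y) 18)) ^ 2

lemma profile_nonneg (y : ℝ) : 0 ≤ profile y := sq_nonneg _

lemma profile_le (y : ℝ) : profile y ≤ 324 := by
  have h1 : max 0 (min (17 - y) 18) ≤ 18 := max_le (by norm_num) (min_le_right _ _)
  have h2 : 0 ≤ max 0 (min (17 - y) 18) := le_max_left _ _
  unfold profile
  nlinarith

lemma profile_antitone : Antitone profile := by
  intro y z h
  unfold profile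
  gcongr

lemma profile_sub_le {y z : ℝ} (h : y ≤ z) : profile y - profile z ≤ 36 * (z - y) := by
  have h1 : max 0 (min (17 - y) 18) ≤ 18 := max_le (by norm_num) (min_le_right _ _)
  have h2 : 0 ≤ max 0 (min (17 - z) 18) := le_max_left _ _
  have h3 : max 0 (min (17 - z) 18) ≤ max 0 (min (17 - y) 18) := by gcongr
  have h4 : max 0 (min (17 - y) 18) - max 0 (min (17 - z) 18) ≤ z - y := by
    simp only [max_def, min_def]
    split_ifs <;> linarith
  unfold profile
  nlinarith

/-- A bin hit with probability `ε` makes a mean-zero move of variance `ε * (1 - ε) ≥ ε / 2`, and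
`profile` is a square of slope-one arguments up to `17`. The factor `1 - y / 16` makes the bound
linear in `y`, so that it can be summed against zero total excess. -/
lemma profile_convexity_gain {y ε : ℝ} (hy : 0 ≤ y) (hε : 0 < ε) (hε' : ε ≤ 1 / 2) :
    ε / 2 * (1 - y / 16) ≤
      profile (y - ε) - profile y - ε * (profile (y - ε) - profile (y + 1 - ε)) := by
  unfold profile
  rcases le_or_gt y 16 with h | h
  · rw [min_eq_left (by linarith), min_eq_left (by linarith), min_eq_left (by linarith),
      max_eq_right (by linarith), max_eq_right (by linarith), max_eq_right (by linarith)]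
    nlinarith [mul_nonneg hε.le hy, mul_nonneg hε.le (sub_nonneg.2 hε')]
  -- Here the claimed gain is negative, so Jensen suffices: the tangent bounds `key` are averaged
  -- over the mean-zero shifts `ε` and `ε - 1`.
  · rw [min_eq_left (by linarith), min_eq_left (by linarith), min_eq_left (by linarith)]
    set w := max 0 (17 - y)
    have hw : 0 ≤ w := le_max_left _ _
    have key : ∀ s : ℝ, w ^ 2 + 2 * w * s ≤ (max 0 (17 - y + s)) ^ 2 := by
      intro s
      have h1 : w * (w + s) ≤ w * max 0 (17 - y + s) := by
        rcases le_or_gt (17 - y) 0 with h0 | h0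
        · simp [w, h0]
        · have : w = 17 - y := max_eq_right h0.le
          rw [this]
          exact mul_le_mul_of_nonneg_left (le_max_right _ _) h0.le
      nlinarith [sq_nonneg (max 0 (17 - y + s) - w)]
    have k1 := key ε
    have k2 := key (ε - 1)
    rw [show 17 - (y - ε) = 17 - y + ε by ring, show 17 - (y + 1 - ε) = 17 - y + (ε - 1) by ring]
    have e1 := mul_le_mul_of_nonneg_left k1 (by linarith : (0 : ℝ) ≤ 1 - ε)
    have e2 := mul_le_mul_of_nonneg_left k2 hε.le
    nlinarith

/-! ### Averages over one round -/

/-- The mean over a round: `A i` if the first sample `i` satisfies `u`, otherwise `B j` with `j`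
the second sample. -/
def roundMean {n : ℕ} (u : Fin n → Prop) [DecidablePred u] (A B : Fin n → ℝ) : ℝ :=
  (n : ℝ)⁻¹ * ∑ i, if u i then A i else (n : ℝ)⁻¹ * ∑ j, B j

section roundMean

variable {n : ℕ} (u : Fin n → Prop) [DecidablePred u]

lemma roundMean_mono {A A' B B' : Fin n → ℝ} (hA : ∀ i, u i → A i ≤ A' i)
    (hB : ∀ i, B i ≤ B' i) : roundMean u A B ≤ roundMean u A' B' := by
  unfold roundMean
  gcongr with i
  split_ifs with h
  · exact hA i h
  · gcongr with j
    exact hB j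

lemma roundMean_add (A A' B B' : Fin n → ℝ) :
    roundMean u (fun i => A i + A' i) (fun i => B i + B' i)
      = roundMean u A B + roundMean u A' B' := by
  unfold roundMean
  rw [← mul_add, ← Finset.sum_add_distrib]
  congr 1
  refine Finset.sum_congr rfl fun i _ => ?_
  split_ifs
  · rfl
  · rw [Finset.sum_add_distrib, mul_add]

lemma roundMean_mul (c : ℝ) (A B : Fin n → ℝ) :
    roundMean u (fun i => c * A i) (fun i => c * B i) = c * roundMean u A B := by
  unfold roundMean
  simp only [← Finset.mul_sum, mul_left_comm _ c, ← mul_ite]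

lemma roundMean_const [NeZero n] (c : ℝ) : roundMean u (fun _ => c) (fun _ => c) = c := by
  have hn : (n : ℝ) ≠ 0 := by exact_mod_cast NeZero.ne n
  simp [roundMean, hn]

/-- A bin is hit with probability at most `2 / n` if it satisfies `u`, and at most `1 / n`
otherwise. -/
lemma roundMean_le_of_nonneg [NeZero n] (A : Fin n → ℝ) (hA : ∀ i, 0 ≤ A i) :
    roundMean u A A ≤ (n : ℝ)⁻¹ * ∑ i, ((if u i then A i else 0) + A i) := by
  have hn : (n : ℝ) ≠ 0 := by exact_mod_cast NeZero.ne n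
  have hS : 0 ≤ ∑ j, A j := Finset.sum_nonneg fun i _ => hA i
  unfold roundMean
  refine mul_le_mul_of_nonneg_left ?_ (by positivity)
  calc _ ≤ ∑ i, ((if u i then A i else 0) + (n : ℝ)⁻¹ * ∑ j, A j) := by
        refine Finset.sum_le_sum fun i _ => ?_
        split_ifs
        · have : 0 ≤ (n : ℝ)⁻¹ * ∑ j, A j := by positivity
          linarith
        · simp
    _ = _ := by
        rw [Finset.sum_add_distrib, Finset.sum_add_distrib]
        simp [hn]

lemma roundMean_of_sum_eq_zero (A : Fin n → ℝ) (hA : ∑ i, A i = 0) :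
    roundMean u A A = (n : ℝ)⁻¹ * ∑ i, if u i then A i else 0 := by
  simp [roundMean, hA]

lemma roundMean_indicator :
    roundMean u (fun _ => 1) (fun _ => 0) = (n : ℝ)⁻¹ * ∑ i, if u i then (1 : ℝ) else 0 := by
  simp [roundMean]

end roundMean

/-! ### Nonnegative drift -/

/-- The change of `∑ i, profile (y i)` when bin `j` receives a ball. -/
def profileChange {n : ℕ} (y : Fin n → ℝ) (j : Fin n) : ℝ :=
  ∑ i, (profile (y i - (n : ℝ)⁻¹) - profile (y i))
    - (profile (y j - (n : ℝ)⁻¹) - profile (y j + 1 - (n : ℝ)⁻¹))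

lemma abs_profileChange_le {n : ℕ} [NeZero n] (y : Fin n → ℝ) (j : Fin n) :
    |profileChange y j| ≤ 36 := by
  have hn : 0 < (n : ℝ) := by exact_mod_cast Nat.pos_of_ne_zero (NeZero.ne n)
  have hi : 0 < (n : ℝ)⁻¹ := by positivity
  have h1 : 0 ≤ ∑ i, (profile (y i - (n : ℝ)⁻¹) - profile (y i)) :=
    Finset.sum_nonneg fun i _ => sub_nonneg.2 (profile_antitone (by linarith))
  have h2 : ∑ i, (profile (y i - (n : ℝ)⁻¹) - profile (y i)) ≤ ∑ _i : Fin n, 36 * (n : ℝ)⁻¹ :=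
    Finset.sum_le_sum fun i _ => (profile_sub_le (by linarith)).trans (by linarith)
  have h3 : ∑ _i : Fin n, 36 * (n : ℝ)⁻¹ = 36 := by
    simp; field_simp
  have h4 : profile (y j + 1 - (n : ℝ)⁻¹) ≤ profile (y j - (n : ℝ)⁻¹) :=
    profile_antitone (by linarith)
  have h5 : profile (y j - (n : ℝ)⁻¹) - profile (y j + 1 - (n : ℝ)⁻¹) ≤ 36 * 1 :=
    (profile_sub_le (by linarith)).trans (by linarith)
  unfold profileChange
  rw [abs_le]
  constructor <;> linarith

/-- The change of the submartingale potential in a round, apart from the `649` gained when the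
first sample is underloaded. -/
def drift {n : ℕ} (y : Fin n → ℝ) (j : Fin n) : ℝ :=
  profileChange y j - (2 * y j + 1 - (n : ℝ)⁻¹) / 64 - 1 / 4

/-- Overloaded bins gain by convexity; an underloaded bin, hit with probability at most `2 / n`,
costs at most `2 * 324 / n`. -/
lemma roundMean_profileChange_ge {n : ℕ} [NeZero n] (hn2 : 2 ≤ n) (y : Fin n → ℝ)
    (u : Fin n → Prop) [DecidablePred u] (hu : ∀ i, u i ↔ y i < 0) :
    (n : ℝ)⁻¹ * ∑ i, (if u i then (-648 : ℝ) else 1 / 2 * (1 - y i / 16))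
      ≤ roundMean u (profileChange y) (profileChange y) := by
  have hn : 0 < (n : ℝ) := by exact_mod_cast Nat.pos_of_ne_zero (NeZero.ne n)
  have hi : 0 < (n : ℝ)⁻¹ := by positivity
  have hi2 : (n : ℝ)⁻¹ ≤ 1 / 2 := by
    rw [one_div]; gcongr; exact_mod_cast hn2
  have hl : ∀ i, 0 ≤ profile (y i - (n : ℝ)⁻¹) - profile (y i + 1 - (n : ℝ)⁻¹) := fun i =>
    sub_nonneg.2 (profile_antitone (by linarith))
  have h1 := roundMean_le_of_nonneg u _ hl
  have h2 : roundMean u (profileChange y) (profileChange y)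
      = ∑ i, (profile (y i - (n : ℝ)⁻¹) - profile (y i))
        + -1 * roundMean u (fun i => profile (y i - (n : ℝ)⁻¹) - profile (y i + 1 - (n : ℝ)⁻¹))
          (fun i => profile (y i - (n : ℝ)⁻¹) - profile (y i + 1 - (n : ℝ)⁻¹)) := by
    rw [← roundMean_mul]
    conv_rhs => rw [← roundMean_const u (∑ i, (profile (y i - (n : ℝ)⁻¹) - profile (y i)))]
    rw [← roundMean_add]
    congr 1 <;> ext i <;> simp only [profileChange] <;> ring
  rw [h2]
  have h3 : (n : ℝ)⁻¹ * ∑ i, (if u i then (-648 : ℝ) else 1 / 2 * (1 - y i / 16))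
      ≤ ∑ i, (profile (y i - (n : ℝ)⁻¹) - profile (y i)) - (n : ℝ)⁻¹ * ∑ i,
        ((if u i then profile (y i - (n : ℝ)⁻¹) - profile (y i + 1 - (n : ℝ)⁻¹) else 0)
          + (profile (y i - (n : ℝ)⁻¹) - profile (y i + 1 - (n : ℝ)⁻¹))) := by
    rw [Finset.mul_sum, Finset.mul_sum, ← Finset.sum_sub_distrib]
    refine Finset.sum_le_sum fun i _ => ?_
    split_ifs with h
    · have a1 : profile (y i) ≤ profile (y i - (n : ℝ)⁻¹) := profile_antitone (by linarith)
      have a2 := profile_le (y i - (n : ℝ)⁻¹)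
      have a3 := profile_nonneg (y i + 1 - (n : ℝ)⁻¹)
      nlinarith
    · rw [hu, not_lt] at h
      have := profile_convexity_gain h hi hi2
      linarith
  linarith

/-- An underloaded bin contributes `649 - 648 - y i / 32`, an overloaded one `1 / 2 - y i / 32`. As
the `y i` sum to zero, the average is at least `1 / 2`, which covers the constant losses. -/
lemma roundMean_drift_nonneg {n : ℕ} [NeZero n] (hn2 : 2 ≤ n) (y : Fin n → ℝ)
    (hy : ∑ i, y i = 0) (u : Fin n → Prop) [DecidablePred u] (hu : ∀ i, u i ↔ y i < 0) :
    0 ≤ roundMean u (fun i => 649 + drift y i) (drift y) := by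
  have hn : 0 < (n : ℝ) := by exact_mod_cast Nat.pos_of_ne_zero (NeZero.ne n)
  have hi : 0 < (n : ℝ)⁻¹ := by positivity
  have h1 := roundMean_profileChange_ge hn2 y u hu
  have h2 : roundMean u (fun i => 649 + drift y i) (drift y)
      = 649 * roundMean u (fun _ => 1) (fun _ => 0)
        + (roundMean u (profileChange y) (profileChange y)
          + (-(1 / 32) * roundMean u y y + (-(1 - (n : ℝ)⁻¹) / 64 - 1 / 4))) := by
    conv_rhs => rw [← roundMean_const u (-(1 - (n : ℝ)⁻¹) / 64 - 1 / 4)]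
    rw [← roundMean_mul, ← roundMean_mul, ← roundMean_add, ← roundMean_add, ← roundMean_add]
    congr 1 <;> ext i <;> simp only [drift] <;> ring
  rw [h2, roundMean_indicator, roundMean_of_sum_eq_zero u y hy]
  have h3 : (n : ℝ)⁻¹ * ∑ i, (1 / 2 - 1 / 32 * y i) ≤
      649 * ((n : ℝ)⁻¹ * ∑ i, if u i then (1 : ℝ) else 0)
      + ((n : ℝ)⁻¹ * ∑ i, (if u i then (-648 : ℝ) else 1 / 2 * (1 - y i / 16))
        + -(1 / 32) * ((n : ℝ)⁻¹ * ∑ i, if u i then y i else 0)) := by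
    rw [mul_left_comm _ (n : ℝ)⁻¹, mul_left_comm _ (n : ℝ)⁻¹, ← mul_add, ← mul_add,
      Finset.mul_sum _ _ (649 : ℝ), Finset.mul_sum _ _ (-(1 / 32) : ℝ), ← Finset.sum_add_distrib,
      ← Finset.sum_add_distrib]
    gcongr with i
    split_ifs <;> linarith
  have h4 : (n : ℝ)⁻¹ * ∑ i, (1 / 2 - 1 / 32 * y i) = 1 / 2 := by
    rw [Finset.sum_sub_distrib, ← Finset.mul_sum, hy]
    simp; field_simp
  linarith

lemma roundMean_nonpos {n : ℕ} (y : Fin n → ℝ)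
    (hy : ∑ i, y i = 0) (u : Fin n → Prop) [DecidablePred u] (hu : ∀ i, u i ↔ y i < 0) :
    roundMean u y y ≤ 0 := by
  rw [roundMean_of_sum_eq_zero u y hy]
  refine mul_nonpos_of_nonneg_of_nonpos (by positivity) (Finset.sum_nonpos fun i _ => ?_)
  split_ifs with h
  · exact ((hu i).1 h).le
  · exact le_rfl

lemma roundMean_sq_le {n : ℕ} [NeZero n] (y : Fin n → ℝ) (u : Fin n → Prop) [DecidablePred u] :
    roundMean u (fun i => y i ^ 2) (fun i => y i ^ 2) ≤ 2 * (n : ℝ)⁻¹ * ∑ i, y i ^ 2 := by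
  refine (roundMean_le_of_nonneg u _ fun i => sq_nonneg _).trans ?_
  rw [mul_assoc, mul_left_comm, Finset.mul_sum _ _ (2 : ℝ)]
  gcongr with i
  have := sq_nonneg (y i)
  split_ifs <;> linarith

lemma drift_sq_le {n : ℕ} [NeZero n] (y : Fin n → ℝ) (j : Fin n) {a : ℝ} (h0 : 0 ≤ a)
    (ha : a ≤ 649) : (a + drift y j) ^ 2 ≤ 1000000 + 1 / 512 * y j ^ 2 := by
  have hn : 1 ≤ (n : ℝ) := by exact_mod_cast Nat.pos_of_ne_zero (NeZero.ne n)
  have hi : 0 ≤ (n : ℝ)⁻¹ := by positivity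
  have hi1 : (n : ℝ)⁻¹ ≤ 1 := inv_le_one_of_one_le₀ hn
  have h := abs_le.1 (abs_profileChange_le y j)
  set c := a + profileChange y j - (1 - (n : ℝ)⁻¹) / 64 - 1 / 4
  have h1 : a + drift y j = c - y j / 32 := by simp only [drift, c]; ring
  have h2 : -700 ≤ c := by simp only [c]; linarith
  have h3 : c ≤ 700 := by simp only [c]; linarith
  -- `(c - y / 32)² ≤ 2 * c² + 2 * (y / 32)²`, with `2 * 700² < 1000000`.
  rw [h1]
  nlinarith [sq_nonneg (c + y j / 32)]

/-! ### The potentials and their one-round changes -/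

/-- The load of bin `i` minus the mean load. -/
def excess {n : ℕ} (t : ℕ) (σ : State n) (i : Fin n) : ℝ := (σ.1 i : ℝ) - (t : ℝ) / (n : ℝ)

/-- The quadratic potential. -/
def quadratic {n : ℕ} (t : ℕ) (σ : State n) : ℝ := ∑ i, excess t σ i ^ 2

/-- A potential with nonnegative drift, in which `2 * t - σ.2` counts the rounds whose first sample
was underloaded. -/
def potential {n : ℕ} (t : ℕ) (σ : State n) : ℝ :=
  649 * (2 * (t : ℝ) - σ.2) + ∑ i, profile (excess t σ i) - quadratic t σ / 64 - (t : ℝ) / 4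

section OneRound

variable {n : ℕ} {t : ℕ} {σ : State n}

lemma sum_excess [NeZero n] (h : ∑ i, σ.1 i = t) : ∑ i, excess t σ i = 0 := by
  have hn : (n : ℝ) ≠ 0 := by exact_mod_cast NeZero.ne n
  simp only [excess, Finset.sum_sub_distrib, ← Nat.cast_sum, h]
  simp; field_simp; ring

lemma excess_addBall (j i : Fin n) (s : ℕ) :
    excess (t + 1) (addBall σ.1 j, s) i
      = if i = j then excess t σ i + 1 - (n : ℝ)⁻¹ else excess t σ i - (n : ℝ)⁻¹ := by
  unfold excess addBall
  by_cases h : i = j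
  · subst h; simp; ring
  · simp [h]; ring

lemma sum_excess_addBall (F : ℝ → ℝ) (j : Fin n) (s : ℕ) :
    ∑ i, F (excess (t + 1) (addBall σ.1 j, s) i)
      = ∑ i, F (excess t σ i - (n : ℝ)⁻¹)
        - (F (excess t σ j - (n : ℝ)⁻¹) - F (excess t σ j + 1 - (n : ℝ)⁻¹)) := by
  rw [eq_sub_iff_add_eq, ← eq_sub_iff_add_eq', ← Finset.sum_sub_distrib,
    Finset.sum_eq_single j]
  · simp [excess_addBall]
  · intro i _ h
    simp [excess_addBall, h]
  · simp

lemma quadratic_addBall [NeZero n] (h : ∑ i, σ.1 i = t) (j : Fin n) (s : ℕ) :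
    quadratic (t + 1) (addBall σ.1 j, s)
      = quadratic t σ + (2 * excess t σ j + 1 - (n : ℝ)⁻¹) := by
  have hn : (n : ℝ) ≠ 0 := by exact_mod_cast NeZero.ne n
  have h1 : ∑ i, (excess t σ i - (n : ℝ)⁻¹) ^ 2 = quadratic t σ + (n : ℝ)⁻¹ := by
    have : ∀ i, (excess t σ i - (n : ℝ)⁻¹) ^ 2
        = excess t σ i ^ 2 - 2 * (n : ℝ)⁻¹ * excess t σ i + (n : ℝ)⁻¹ ^ 2 := fun i => by ring
    simp only [this, Finset.sum_add_distrib, Finset.sum_sub_distrib, ← Finset.mul_sum,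
      sum_excess h, quadratic]
    simp; field_simp
  unfold quadratic at *
  rw [sum_excess_addBall (fun y => y ^ 2), h1]
  ring

lemma potential_addBall_one [NeZero n] (h : ∑ i, σ.1 i = t) (j : Fin n) :
    potential (t + 1) (addBall σ.1 j, σ.2 + 1)
      = potential t σ + (649 + drift (excess t σ) j) := by
  unfold potential
  rw [sum_excess_addBall profile, quadratic_addBall h]
  simp only [drift, profileChange, Finset.sum_sub_distrib]
  push_cast
  ring

lemma potential_addBall_two [NeZero n] (h : ∑ i, σ.1 i = t) (j : Fin n) :
    potential (t + 1) (addBall σ.1 j, σ.2 + 2) = potential t σ + drift (excess t σ) j := by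
  unfold potential
  rw [sum_excess_addBall profile, quadratic_addBall h]
  simp only [drift, profileChange, Finset.sum_sub_distrib]
  push_cast
  ring

/-- The squared negative part of `potential`, with a correction for the conditional variance over
the rounds from `t` to `T`. -/
def deficit {n : ℕ} (T t : ℕ) (σ : State n) : ℝ :=
  max 0 (-potential t σ) ^ 2 + (n : ℝ)⁻¹ / 256 * ((T : ℝ) - t) * quadratic t σ

/-- The squared negative part has derivative `-2 * max 0 (-a)`, which is 2-Lipschitz. -/
lemma max_neg_add_sq_le (a d : ℝ) :
    max 0 (-(a + d)) ^ 2 ≤ max 0 (-a) ^ 2 + (-2 * max 0 (-a)) * d + d ^ 2 := by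
  rcases le_total (-(a + d)) 0 with h | h
  · rw [max_eq_left h]
    nlinarith [sq_nonneg (max 0 (-a) - d)]
  · rw [max_eq_right h]
    rcases le_total (-a) 0 with h' | h'
    · rw [max_eq_left h']; nlinarith
    · rw [max_eq_right h']; nlinarith

/-- The first-order term is nonpositive by the drift. The variance costs `1000000` plus `quadratic /
(256 * n)`, exactly what the shrinking coefficient releases; `quadratic` itself grows by at most one
in mean. -/
lemma stepMean_deficit_le [NeZero n] (hn2 : 2 ≤ n) {T : ℕ} (ht : t < T) (h : ∑ i, σ.1 i = t) :
    stepMean t σ (deficit T (t + 1)) ≤ deficit T t σ + (1000000 + (T : ℝ) / (256 * n)) := by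
  classical
  have hn : 0 < (n : ℝ) := by exact_mod_cast Nat.pos_of_ne_zero (NeZero.ne n)
  have hi : 0 < (n : ℝ)⁻¹ := by positivity
  set u : Fin n → Prop := fun i => (σ.1 i : ℝ) < (t : ℝ) / (n : ℝ) with hu_def
  set y := excess t σ with hy_def
  have hu : ∀ i, u i ↔ y i < 0 := fun i => by simp [u, y, excess]
  have hy : ∑ i, y i = 0 := sum_excess h
  set N := max 0 (-potential t σ) with hN
  have hN0 : 0 ≤ N := le_max_left _ _
  set κ := (n : ℝ)⁻¹ / 256 * ((T : ℝ) - (t + 1 : ℕ)) with hκ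
  have hTt : ((t + 1 : ℕ) : ℝ) ≤ T := by exact_mod_cast ht
  have hκ0 : 0 ≤ κ := mul_nonneg (by positivity) (by linarith)
  set c := N ^ 2 + 1000000 + κ * (quadratic t σ + 1) with hc
  have bound : ∀ (a : ℝ) (j : Fin n), 0 ≤ a → a ≤ 649 →
      max 0 (-(potential t σ + (a + drift y j))) ^ 2
        + κ * (quadratic t σ + (2 * y j + 1 - (n : ℝ)⁻¹))
      ≤ c + ((-2 * N) * (a + drift y j) + (1 / 512 * y j ^ 2 + 2 * κ * y j)) := by
    intro a j h0 ha
    have e1 := max_neg_add_sq_le (potential t σ) (a + drift y j)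
    have e2 := drift_sq_le y j h0 ha
    have e3 : 0 ≤ κ * (n : ℝ)⁻¹ := by positivity
    rw [← hN] at e1
    simp only [hc]
    linarith
  have h1 : stepMean t σ (deficit T (t + 1)) ≤ roundMean u
      (fun j => c + ((-2 * N) * (649 + drift y j) + (1 / 512 * y j ^ 2 + 2 * κ * y j)))
      (fun j => c + ((-2 * N) * drift y j + (1 / 512 * y j ^ 2 + 2 * κ * y j))) := by
    refine roundMean_mono u (A := fun i => deficit T (t + 1) (addBall σ.1 i, σ.2 + 1))
      (B := fun i => deficit T (t + 1) (addBall σ.1 i, σ.2 + 2)) (fun i _ => ?_) (fun i => ?_)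
    · simp only [deficit]
      rw [potential_addBall_one h, quadratic_addBall h]
      exact bound 649 i (by norm_num) le_rfl
    · simp only [deficit]
      rw [potential_addBall_two h, quadratic_addBall h]
      have := bound 0 i le_rfl (by norm_num)
      rw [zero_add] at this
      exact this
  clear_value c
  rw [roundMean_add, roundMean_add, roundMean_add, roundMean_const, roundMean_mul, roundMean_mul,
    roundMean_mul] at h1
  have h2 := mul_nonneg hN0 (roundMean_drift_nonneg hn2 y hy u hu)
  have h3 := roundMean_sq_le y u
  have h4 := mul_nonneg_of_nonpos_of_nonpos (neg_nonpos.2 hκ0) (roundMean_nonpos y hy u hu)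
  have h5 : deficit T t σ = N ^ 2 + (κ + (n : ℝ)⁻¹ / 256) * quadratic t σ := by
    simp only [deficit, hκ, hN]; push_cast; ring
  have h6 : κ ≤ (T : ℝ) / (256 * n) := by
    have : (T : ℝ) / (256 * n) = (n : ℝ)⁻¹ / 256 * T := by field_simp
    rw [this, hκ]
    gcongr
    have : (0 : ℝ) ≤ (t + 1 : ℕ) := by positivity
    linarith
  have h7 : ∑ i, y i ^ 2 = quadratic t σ := rfl
  rw [h7] at h3
  rw [h5]
  rw [hc] at h1
  linarith

end OneRound

/-! ### Tail bound and efficiency -/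

lemma lintegral_deficit_le {n : ℕ} [NeZero n] (hn2 : 2 ≤ n) (T : ℕ) :
    ∫⁻ σ, ENNReal.ofReal (max 0 (-potential T σ) ^ 2) ∂prob n T
      ≤ ENNReal.ofReal ((1000000 + (T : ℝ) / (256 * n)) * T) := by
  have hd : ∀ σ : State n, max 0 (-potential T σ) ^ 2 = deficit T T σ := by
    intro σ; simp [deficit]
  simp only [hd, lintegral_prob]
  refine tsum_law_mul_le T _ (by positivity) (deficit T) ?_ ?_ ?_ T le_rfl
  · intro t ht σ
    have : (t : ℝ) ≤ T := by exact_mod_cast ht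
    have hq : 0 ≤ quadratic t σ := Finset.sum_nonneg fun i _ => sq_nonneg _
    have : 0 ≤ (T : ℝ) - t := by linarith
    unfold deficit
    positivity
  · have hq : quadratic 0 ((fun _ => 0, 0) : State n) = 0 := by simp [quadratic, excess]
    have hp : 0 ≤ potential 0 ((fun _ => 0, 0) : State n) := by
      simp only [potential, hq]
      simpa using Finset.sum_nonneg fun i _ => profile_nonneg _
    simp [deficit, hq, hp]
  · intro t ht σ hσ
    exact stepMean_deficit_le hn2 ht hσ.1

lemma prob_potential_le {n : ℕ} [NeZero n] (hn2 : 2 ≤ n) (T : ℕ)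
    (hT : 128 * 1000000 * (n : ℝ) ≤ T) :
    (prob n T).real {σ | potential T σ ≤ -((T : ℝ) / 8)} ≤ 3 / (4 * n) := by
  have hn : 0 < (n : ℝ) := by positivity
  have hT0 : 0 < (T : ℝ) := by linarith
  have hsub : {σ : State n | potential T σ ≤ -((T : ℝ) / 8)}
      ⊆ {σ | ENNReal.ofReal (((T : ℝ) / 8) ^ 2) ≤ ENNReal.ofReal (max 0 (-potential T σ) ^ 2)} := by
    intro σ hσ
    refine ENNReal.ofReal_le_ofReal (pow_le_pow_left₀ (by positivity) ?_ 2)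
    exact le_max_of_le_right (by linarith [Set.mem_ofPred.1 hσ])
  have h1 := mul_meas_ge_le_lintegral₀ (μ := prob n T)
    (f := fun σ => ENNReal.ofReal (max 0 (-potential T σ) ^ 2))
    (measurable_of_countable _).aemeasurable (ENNReal.ofReal (((T : ℝ) / 8) ^ 2))
  have h2 := (mul_le_mul_right (measure_mono (μ := prob n T) hsub)
    (ENNReal.ofReal (((T : ℝ) / 8) ^ 2))).trans (h1.trans (lintegral_deficit_le hn2 T))
  rw [← ofReal_measureReal, ← ENNReal.ofReal_mul (by positivity),
    ENNReal.ofReal_le_ofReal_iff (by positivity)] at h2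
  set P := (prob n T).real {σ | potential T σ ≤ -((T : ℝ) / 8)}
  -- Dividing by `(T / 8)²` leaves `64 * 1000000 / T + 1 / (4 * n)`, and the lower bound on `T`
  -- makes the first term at most `1 / (2 * n)`.
  have h3 : ((T : ℝ) / 8) ^ 2 * P ≤ ((T : ℝ) / 8) ^ 2 * (3 / (4 * n)) := by
    refine h2.trans ?_
    have e : ((T : ℝ) / 8) ^ 2 * (3 / (4 * n)) - (1000000 + (T : ℝ) / (256 * n)) * T
      = T / (128 * n) * (T - 128 * 1000000 * n) := by field_simp; ring
    have : 0 ≤ T / (128 * n) * (T - 128 * 1000000 * (n : ℝ)) :=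
      mul_nonneg (by positivity) (by linarith)
    linarith
  exact le_of_mul_le_mul_left h3 (by positivity)

/-- Outside the exceptional event, a constant fraction of the rounds take one sample only. -/
lemma efficiency_ge {n : ℕ} [NeZero n] {T : ℕ} (hT : 128 * 1000000 * (n : ℝ) ≤ T) {σ : State n}
    (hσ : Reachable T σ) (hp : -((T : ℝ) / 8) < potential T σ) :
    1 / 2 + 1 / 50000 ≤ efficiency σ := by
  obtain ⟨h1, h2, -⟩ := hσ
  have hn : 0 < (n : ℝ) := by exact_mod_cast Nat.pos_of_ne_zero (NeZero.ne n)
  have hT0 : 0 < (T : ℝ) := by linarith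
  have hs : (T : ℝ) ≤ σ.2 := by exact_mod_cast h2
  have hq : 0 ≤ quadratic T σ := Finset.sum_nonneg fun i _ => sq_nonneg _
  have hg : ∑ i, profile (excess T σ i) ≤ n * 324 := by
    refine (Finset.sum_le_sum fun i _ => profile_le _).trans ?_
    simp
  -- What remains is `649 * (2 * T - σ.2) > T / 8 - 324 * n`, where `324 * n` is negligible against
  -- `T`.
  unfold potential at hp
  rw [efficiency, h1, le_div_iff₀ (by linarith)]
  linarith

lemma half_le_efficiency {n : ℕ} {T : ℕ} (hT : 0 < T) {σ : State n}
    (hσ : Reachable T σ) : 1 / 2 ≤ efficiency σ ∧ efficiency σ ≤ 1 := by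
  obtain ⟨h1, h2, h3⟩ := hσ
  have hT0 : 0 < (T : ℝ) := by exact_mod_cast hT
  have hs : (T : ℝ) ≤ σ.2 := by exact_mod_cast h2
  have hs' : (σ.2 : ℝ) ≤ 2 * T := by exact_mod_cast h3
  rw [efficiency, h1, le_div_iff₀ (by linarith), div_le_iff₀ (by linarith)]
  constructor <;> linarith

lemma prob_efficiency_ge {n : ℕ} [NeZero n] (hn2 : 2 ≤ n) (T : ℕ)
    (hT : 128 * 1000000 * (n : ℝ) ≤ T) :
    1 - 3 / (4 * n) ≤ (prob n T).real {σ | 1 / 2 + 1 / 50000 ≤ efficiency σ} := by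
  have h1 := prob_potential_le hn2 T hT
  have h2 := probReal_compl_eq_one_sub (μ := prob n T)
    (s := {σ | potential T σ ≤ -((T : ℝ) / 8)}) (Set.to_countable _).measurableSet
  have h3 : (prob n T).real {σ | potential T σ ≤ -((T : ℝ) / 8)}ᶜ
      ≤ (prob n T).real {σ | 1 / 2 + 1 / 50000 ≤ efficiency σ} := by
    refine ENNReal.toReal_mono (measure_ne_top _ _) (measure_mono_ae ?_)
    filter_upwards [ae_reachable (n := n) T] with σ hσ hp
    exact efficiency_ge hT hσ (not_le.1 hp)
  linarith

lemma integral_efficiency_ge {n : ℕ} [NeZero n] {T : ℕ} (hT : 0 < T) {r : ℝ} :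
    1 / 2 + r * (prob n T).real {σ | 1 / 2 + r ≤ efficiency σ}
      ≤ ∫ σ, efficiency σ ∂prob n T := by
  have hA : MeasurableSet {σ : State n | 1 / 2 + r ≤ efficiency σ} :=
    (Set.to_countable _).measurableSet
  have hi : Integrable ({σ : State n | 1 / 2 + r ≤ efficiency σ}.indicator fun _ => r)
      (prob n T) := (integrable_const r).indicator hA
  calc _ = ∫ σ, (1 / 2 + {σ : State n | 1 / 2 + r ≤ efficiency σ}.indicator (fun _ => r) σ)
        ∂prob n T := by
        rw [integral_add (integrable_const _) hi, integral_indicator_const _ hA]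
        simp [mul_comm]
    _ ≤ _ := by
        refine integral_mono_ae ((integrable_const _).add hi) ?_ ?_
        · refine Integrable.of_bound (measurable_of_countable _).aestronglyMeasurable 1 ?_
          filter_upwards [ae_reachable (n := n) T] with σ hσ
          have := half_le_efficiency hT hσ
          rw [Real.norm_eq_abs, abs_le]
          constructor <;> linarith
        · filter_upwards [ae_reachable (n := n) T] with σ hσ
          by_cases h : 1 / 2 + r ≤ efficiency σ
          · rw [Set.indicator_of_mem (by exact h)]
            exact h
          · rw [Set.indicator_of_notMem (by exact h), add_zero]
            exact (half_le_efficiency hT hσ).1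

end MeanThinning

end

open MeanThinning in
theorem lemma3p4 :
    ∃ ρ : ℝ, 0 < ρ ∧
      ∀ (n : ℕ) [NeZero n], 2 ≤ n →
      ∀ m : ℕ, ρ⁻¹ * ((n : ℝ) * Real.log (n : ℝ)) ≤ (m : ℝ) →
        1 / 2 + ρ ≤ ∫ σ, MeanThinning.efficiency σ ∂(MeanThinning.prob n m) ∧
        1 - (n : ℝ) ^ (-(1 / 4) : ℝ) ≤
          (MeanThinning.prob n m).real {σ | 1 / 2 + ρ ≤ MeanThinning.efficiency σ} := by
  -- The logarithm serves only through `log n ≥ 0.69`, since linearly many rounds suffice; `10⁹ *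
  -- 0.69` exceeds `128 * 10⁶`.
  refine ⟨1 / 1000000000, by norm_num, fun n _ hn2 m hm => ?_⟩
  have hn2' : (2 : ℝ) ≤ n := by exact_mod_cast hn2
  have hlog : 0.69 ≤ Real.log n :=
    (by linarith [Real.log_two_gt_d9] : 0.69 ≤ Real.log 2).trans
      (Real.log_le_log (by norm_num) hn2')
  have hT : 128 * 1000000 * (n : ℝ) ≤ m := by
    refine le_trans ?_ hm
    norm_num
    nlinarith
  have hm0 : 0 < m := by
    have : 0 < (m : ℝ) := by linarith
    exact_mod_cast this
  have hP := prob_efficiency_ge hn2 m hT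
  have hn_inv : 3 / (4 * (n : ℝ)) ≤ 3 / 8 := by
    rw [div_le_div_iff₀ (by positivity) (by norm_num)]; linarith
  constructor
  · have := integral_efficiency_ge (n := n) hm0 (r := 1 / 50000)
    linarith
  · have h1 : 3 / (4 * (n : ℝ)) ≤ (n : ℝ) ^ (-(1 / 4) : ℝ) := by
      calc 3 / (4 * (n : ℝ)) ≤ (n : ℝ)⁻¹ := by
            rw [div_le_iff₀ (by positivity)]; field_simp; norm_num
        _ = (n : ℝ) ^ (-1 : ℝ) := (Real.rpow_neg_one _).symm
        _ ≤ _ := Real.rpow_le_rpow_of_exponent_le (by linarith) (by norm_num)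
    have h2 : (prob n m).real {σ | 1 / 2 + 1 / 50000 ≤ efficiency σ}
        ≤ (prob n m).real {σ | 1 / 2 + 1 / 1000000000 ≤ efficiency σ} := by
      refine measureReal_mono fun σ hσ => ?_
      simp only [Set.mem_ofPred_eq] at hσ ⊢
      linarith
    linarith
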